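/- Let $X$ be a compact Hausdorff space and let $T$ be a topological group acting continuously on $X$ from the left, i.e. the action map $T\times X\to X$, $(t,x)\mapsto tx$, is continuous. A point $x\in X$ is called almost automorphic if for every net $(t_i)_{i\in I}$ in $T$ and every $y\in X$ with $t_i x\to y$ one has $t_i^{-1}y\to x$. The enveloping semigroup $\mathcal E(X,T)$ is the closure of the set of maps $\{x\mapsto tx : t\in T\}$ in the product space $X^X$; it is a semigroup under composition of maps, and it is given the subspace topology, which is the topology of pointwise convergence. Then every point of $X$ is almost automorphic if and only if $\mathcal E(X,T)$, with composition as multiplication and the topology of pointwise convergence, is a compact Hausdorff topological group (that is, it is a group under composition, multiplication $\mathcal E(X,T)\times\mathcal E(X,T)\to\mathcal E(X,T)$ and inversion are continuous, and the topology is compact and Hausdorff). -/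

import Mathlib

open Set Filter Topology

universe u v

/-- A point `x` of a flow `(X, T)` is almost automorphic if for every net `(t i)` in `T` and every
`y : X` with `t i • x → y` one has `(t i)⁻¹ • y → x`. Nets are indexed by arbitrary nonempty
directed preordered types in the universe of `T`; by `isAlmostAutomorphic_iff_filter` this is no
restriction. -/
def IsAlmostAutomorphic (T : Type u) {X : Type v} [Group T] [MulAction T X]
    [TopologicalSpace X] (x : X) : Prop :=
  ∀ (I : Type u) [Preorder I] [IsDirectedOrder I] [Nonempty I] (t : I → T) (y : X),
    Tendsto (fun i => t i • x) atTop (𝓝 y) → Tendsto (fun i => (t i)⁻¹ • y) atTop (𝓝 x)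

/-- The definition through nets agrees with the one through arbitrary filters on `T`. -/
theorem isAlmostAutomorphic_iff_filter {T : Type u} {X : Type v} [Group T] [MulAction T X]
    [TopologicalSpace X] (x : X) :
    IsAlmostAutomorphic T x ↔ ∀ (F : Filter T) (y : X),
      Tendsto (fun t : T => t • x) F (𝓝 y) → Tendsto (fun t : T => t⁻¹ • y) F (𝓝 x) := by
  constructor
  · intro h F y hF
    rcases F.eq_or_neBot with rfl | hne
    · exact tendsto_bot
    -- the canonical net of the filter: pairs `(A, a)` with `a ∈ A ∈ F`, ordered by reverse
    -- inclusion of the first component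
    let J : Type u := {p : Set T × T // p.1 ∈ F ∧ p.2 ∈ p.1}
    let _ : Preorder J :=
      { le := fun p q => q.1.1 ⊆ p.1.1
        le_refl := fun p => Subset.rfl
        le_trans := fun p q r hpq hqr => Subset.trans hqr hpq }
    have : IsDirectedOrder J := ⟨fun p q => by
      have hA : p.1.1 ∩ q.1.1 ∈ F := inter_mem p.2.1 q.2.1
      obtain ⟨a, ha⟩ := hne.nonempty_of_mem hA
      exact ⟨⟨(p.1.1 ∩ q.1.1, a), hA, ha⟩, inter_subset_left, inter_subset_right⟩⟩
    have : Nonempty J := by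
      obtain ⟨a, ha⟩ := hne.nonempty_of_mem univ_mem
      exact ⟨⟨(univ, a), univ_mem, ha⟩⟩
    have key : map (fun j : J => j.1.2) atTop = F := by
      ext A
      rw [mem_map, mem_atTop_sets]
      constructor
      · rintro ⟨j, hj⟩
        refine mem_of_superset j.2.1 fun a ha => ?_
        exact hj ⟨(j.1.1, a), j.2.1, ha⟩ Subset.rfl
      · intro hA
        obtain ⟨a, ha⟩ := hne.nonempty_of_mem hA
        exact ⟨⟨(A, a), hA, ha⟩, fun k hk => hk k.2.2⟩
    have h1 := h J (fun j : J => j.1.2) y (by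
      rw [← key, tendsto_map'_iff] at hF
      exact hF)
    rw [← key, tendsto_map'_iff]
    exact h1
  · intro h I _ _ _ t y ht
    exact tendsto_map'_iff.1 (h (map t atTop) y (tendsto_map'_iff.2 ht))

/-- The (underlying set of the) enveloping semigroup of the flow `(X, T)`: the closure, in the
product space `X → X`, of the set of all translations `x ↦ t • x`. It carries the subspace topology,
that is, the topology of pointwise convergence. -/
def envelopingSemigroup (T : Type u) (X : Type v) [Group T] [MulAction T X]
    [TopologicalSpace X] : Set (X → X) :=
  closure (range fun (t : T) (x : X) => t • x)

theorem comp_mem_envelopingSemigroup {T : Type u} {X : Type v} [Group T] [MulAction T X]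
    [TopologicalSpace X] [ContinuousConstSMul T X] {f g : X → X}
    (hf : f ∈ envelopingSemigroup T X) (hg : g ∈ envelopingSemigroup T X) :
    f ∘ g ∈ envelopingSemigroup T X := by
  have h1 : ∀ t : T, (fun x => t • g x) ∈ envelopingSemigroup T X := by
    intro t
    have hc : Continuous fun (k : X → X) (x : X) => t • k x :=
      continuous_pi fun x => (continuous_apply x).const_smul t
    refine map_mem_closure hc hg ?_
    rintro _ ⟨s, rfl⟩
    exact ⟨t * s, funext fun x => mul_smul t s x⟩
  have hc : Continuous fun k : X → X => k ∘ g :=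
    continuous_pi fun x => continuous_apply (g x)
  have h2 : f ∘ g ∈ closure (envelopingSemigroup T X) := by
    refine map_mem_closure (f := fun k : X → X => k ∘ g) hc hf ?_
    rintro _ ⟨t, rfl⟩
    exact h1 t
  rwa [envelopingSemigroup, closure_closure] at h2

/-- The semigroup operation of the enveloping semigroup is composition of maps. -/
instance envelopingSemigroup.instSemigroup (T : Type u) (X : Type v) [Group T] [MulAction T X]
    [TopologicalSpace X] [ContinuousConstSMul T X] : Semigroup (envelopingSemigroup T X) where
  mul f g := ⟨f.1 ∘ g.1, comp_mem_envelopingSemigroup f.2 g.2⟩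
  mul_assoc _ _ _ := rfl

/-- A semigroup with a topology is a compact Hausdorff topological group: its given multiplication
is that of a group, multiplication and inversion are continuous, and the given topology is compact
and Hausdorff. -/
def IsCompactHausdorffTopologicalGroup (S : Type v) [inst : Semigroup S] [TopologicalSpace S] :
    Prop :=
  ∃ G : Group S, G.toSemigroup = inst ∧ IsTopologicalGroup S ∧ CompactSpace S ∧ T2Space S

/-! If all points are almost automorphic, a limit `q` of the `t⁻¹` along an ultrafilter with `t → p`
satisfies `q ∘ p = id`, so the enveloping semigroup is a group. Almost automorphy also makes
inversion continuous on approach through translations, hence everywhere by density. Composition is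
continuous in its left factor, and inversion transfers this to the right one; Ellis' theorem gives
joint continuity. It rests on `ContinuousMap.continuous_leftTranslate`, a Baire category argument.
The converse takes limits in the compact group. -/

/-- The left translate `y ↦ f (x * y)` of a continuous real function on a group with separately
continuous multiplication. -/
def ContinuousMap.leftTranslate {G : Type*} [Group G] [TopologicalSpace G]
    [SeparatelyContinuousMul G] (f : C(G, ℝ)) (x : G) : C(G, ℝ) :=
  ⟨fun y => f (x * y), f.continuous.comp (continuous_const_mul x)⟩

/-! ### Ellis' theorem: separate to joint continuity. -/

section Ellis

variable {G : Type*} [Group G] [TopologicalSpace G] [SeparatelyContinuousMul G] [CompactSpace G]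

theorem ContinuousMap.dist_leftTranslate_mul_right_le (f : C(G, ℝ)) (x x' h : G) :
    dist (f.leftTranslate (x * h)) (f.leftTranslate (x' * h)) ≤
      dist (f.leftTranslate x) (f.leftTranslate x') := by
  rw [ContinuousMap.dist_le dist_nonneg]
  intro y
  have := ContinuousMap.dist_apply_le_dist (f := f.leftTranslate x) (g := f.leftTranslate x')
    (h * y)
  simpa [ContinuousMap.leftTranslate, mul_assoc] using this

theorem ContinuousMap.dist_leftTranslate_mul_right (f : C(G, ℝ)) (x x' h : G) :
    dist (f.leftTranslate (x * h)) (f.leftTranslate (x' * h)) =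
      dist (f.leftTranslate x) (f.leftTranslate x') := by
  refine le_antisymm (f.dist_leftTranslate_mul_right_le x x' h) ?_
  simpa using f.dist_leftTranslate_mul_right_le (x * h) (x' * h) h⁻¹

/-- Needs no norm continuity: a closed sup-norm ball is cut out by pointwise conditions, each closed
in `x`. -/
theorem ContinuousMap.isClosed_dist_leftTranslate_le (f g : C(G, ℝ)) (ε : ℝ) (hε : 0 ≤ ε) :
    IsClosed {x : G | dist (f.leftTranslate x) g ≤ ε} := by
  simp only [ContinuousMap.dist_le hε, ofPred_forall]
  refine isClosed_iInter fun y => isClosed_le ?_ continuous_const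
  exact (f.continuous.comp (continuous_mul_const y)).dist continuous_const

/-- The left translates of `f` by the closure of a countable set form a norm separable set. -/
theorem ContinuousMap.isSeparable_leftTranslate_image_closure (f : C(G, ℝ)) {D : Set G}
    (hD : D.Countable) : TopologicalSpace.IsSeparable (f.leftTranslate '' closure D) := by
  have : Countable D := hD
  -- As `D` is countable, `range π` is compact metrizable, so its continuous functions form a
  -- separable space. Translates by `closure D` factor through it.
  let π : C(G, D → ℝ) := ⟨fun y d => f (d * y),
    continuous_pi fun d => f.continuous.comp (continuous_const_mul d.1)⟩
  let ρ : C(G, range π) := ⟨rangeFactorization π, π.continuous.subtype_mk _⟩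
  have hρ : IsQuotientMap ρ :=
    IsQuotientMap.of_surjective_continuous rangeFactorization_surjective ρ.continuous
  have : CompactSpace (range π) := isCompact_iff_compactSpace.1 (isCompact_range π.continuous)
  refine (TopologicalSpace.isSeparable_range
    (ContinuousMap.continuous_precomp (Z := ℝ) ρ)).mono ?_
  rintro _ ⟨x, hx, rfl⟩
  have hfac : Function.FactorsThrough (f.leftTranslate x) ρ := by
    intro y y' h
    have h' : π y = π y' := congrArg Subtype.val h
    have hcl : IsClosed {x : G | f (x * y) = f (x * y')} :=
      isClosed_eq (f.continuous.comp (continuous_mul_const y))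
        (f.continuous.comp (continuous_mul_const y'))
    exact closure_minimal (fun d hd => congrFun h' ⟨d, hd⟩) hcl hx
  exact ⟨hρ.lift (f.leftTranslate x) hfac, hρ.lift_comp _ hfac⟩

variable [T2Space G]

/-- Among countably many elements of a compact group with separately continuous multiplication and
continuous inversion, two have uniformly close left translates of `f`. -/
theorem ContinuousMap.exists_dist_leftTranslate_le [ContinuousInv G] (f : C(G, ℝ)) (x : ℕ → G)
    {ε : ℝ} (hε : 0 < ε) :
    ∃ m n, m < n ∧ dist (f.leftTranslate (x m)) (f.leftTranslate (x n)) ≤ ε := by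
  let D : Subgroup G := (FreeGroup.lift x).range
  have hxD : ∀ n, x n ∈ D := fun n => ⟨FreeGroup.of n, by simp⟩
  have hDc : (D : Set G).Countable := by
    have : Countable (FreeGroup ℕ) := inferInstanceAs (Countable (Quot _))
    exact countable_range (FreeGroup.lift x)
  let K : Set G := closure D
  have hDK : (D : Set G) ⊆ K := subset_closure
  have hKD : ∀ a ∈ K, ∀ d ∈ D, a * d ∈ K := fun a ha d hd =>
    map_mem_closure (f := (· * d)) (continuous_mul_const d) ha fun b hb => D.mul_mem hb hd
  have hKK : ∀ a ∈ K, ∀ b ∈ K, a * b ∈ K := fun a ha b hb =>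
    closure_minimal (s := (D : Set G)) (t := {b | a * b ∈ K}) (fun d hd => hKD a ha d hd)
      (isClosed_closure.preimage (continuous_const_mul a)) hb
  have hKinv : ∀ a ∈ K, a⁻¹ ∈ K := fun a ha =>
    map_mem_closure continuous_inv ha fun b hb => D.inv_mem hb
  have hKc : IsCompact K := isClosed_closure.isCompact
  have : CompactSpace K := isCompact_iff_compactSpace.1 hKc
  have : Nonempty K := ⟨⟨1, hDK D.one_mem⟩⟩
  obtain ⟨c, hc, hcl⟩ := f.isSeparable_leftTranslate_image_closure hDc
  have : Countable c := hc
  -- Baire in the compact group `K`: one of countably many balls has interior.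
  obtain ⟨g, hg⟩ := nonempty_interior_of_iUnion_of_closed
    (f := fun g : c => {a : K | dist (f.leftTranslate a) g.1 ≤ ε / 2})
    (fun g => (f.isClosed_dist_leftTranslate_le g.1 _ (half_pos hε).le).preimage
      continuous_subtype_val)
    (by
      refine eq_univ_of_forall fun a => mem_iUnion.2 ?_
      obtain ⟨g, hg, hd⟩ := Metric.mem_closure_iff.1 (hcl ⟨a.1, a.2, rfl⟩) _ (half_pos hε)
      exact ⟨⟨g, hg⟩, hd.le⟩)
  obtain ⟨w, hw⟩ := hg
  obtain ⟨W, hWo, hWeq⟩ := isOpen_induced_iff.1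
    (isOpen_interior (s := {a : K | dist (f.leftTranslate a) g.1 ≤ ε / 2}))
  have hWg : ∀ a ∈ K, a ∈ W → dist (f.leftTranslate a) g.1 ≤ ε / 2 := by
    intro a ha haW
    have : (⟨a, ha⟩ : K) ∈ Subtype.val ⁻¹' W := haW
    rw [hWeq] at this
    simpa using interior_subset this
  have hwW : w.1 ∈ W := by
    rw [← hWeq] at hw
    exact hw
  -- By density some `d ∈ D` near `a⁻¹ * w` moves `a` into `W`. Finitely many such `d` suffice, and
  -- pigeonhole gives two terms sharing one.
  obtain ⟨t, ht⟩ := hKc.elim_finite_subcover (fun d : D => {a : G | a * d.1 ∈ W})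
    (fun d => hWo.preimage (continuous_mul_const d.1)) (by
      intro a ha
      have hmem : a⁻¹ * w.1 ∈ closure (D : Set G) := hKK _ (hKinv a ha) _ w.2
      obtain ⟨d, hd, hdD⟩ := mem_closure_iff.1 hmem {b | a * b ∈ W}
        (hWo.preimage (continuous_const_mul a)) (by simpa using hwW)
      exact mem_iUnion.2 ⟨⟨d, hdD⟩, hd⟩)
  have hsel : ∀ n, ∃ d : t, x n * d.1.1 ∈ W := by
    intro n
    obtain ⟨d, hd, hdW⟩ := mem_iUnion₂.1 (ht (hDK (hxD n)))
    exact ⟨⟨d, hd⟩, hdW⟩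
  choose d hd using hsel
  obtain ⟨m, n, hmn, hdmn⟩ := Finite.exists_ne_map_eq_of_infinite d
  have key : ∀ m n, d m = d n →
      dist (f.leftTranslate (x m)) (f.leftTranslate (x n)) ≤ ε := by
    intro m n h
    rw [← f.dist_leftTranslate_mul_right (x m) (x n) (d m).1.1]
    have h1 := hWg _ (hKD _ (hDK (hxD m)) _ (d m).1.2) (hd m)
    have h2 := hWg _ (hKD _ (hDK (hxD n)) _ (d n).1.2) (hd n)
    rw [← h] at h2
    linarith [dist_triangle_right (f.leftTranslate (x m * (d m).1.1))
      (f.leftTranslate (x n * (d m).1.1)) g.1]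
  rcases lt_or_gt_of_ne hmn with h | h
  · exact ⟨m, n, h, key m n hdmn⟩
  · exact ⟨n, m, h, key n m hdmn.symm⟩

theorem ContinuousMap.continuous_leftTranslate [ContinuousInv G] (f : C(G, ℝ)) :
    Continuous f.leftTranslate := by
  rw [Metric.continuous_iff']
  intro a ε hε
  have hε3 : 0 < ε / 3 := by positivity
  -- Otherwise there is an `ε / 3`-separated sequence.
  obtain ⟨s, hs⟩ : ∃ s : Finset G, ∀ y, ∃ x ∈ s,
      dist (f.leftTranslate y) (f.leftTranslate x) ≤ ε / 3 := by
    by_contra! hcon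
    obtain ⟨x, -, hx⟩ := exists_seq_of_forall_finset_exists (fun _ : G => True)
      (fun x y => ε / 3 < dist (f.leftTranslate y) (f.leftTranslate x))
      (fun s _ => (hcon s).imp fun y hy => ⟨trivial, hy⟩)
    obtain ⟨m, n, hmn, hd⟩ := f.exists_dist_leftTranslate_le x hε3
    have := hx m n hmn
    rw [dist_comm] at this
    linarith
  have : Nonempty G := ⟨1⟩
  obtain ⟨x, b, hb⟩ := nonempty_interior_of_iUnion_of_closed
    (f := fun x : s => {y | dist (f.leftTranslate y) (f.leftTranslate x.1) ≤ ε / 3})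
    (fun x => f.isClosed_dist_leftTranslate_le _ _ hε3.le)
    (eq_univ_of_forall fun y => by
      obtain ⟨x, hx, hd⟩ := hs y
      exact mem_iUnion.2 ⟨⟨x, hx⟩, hd⟩)
  -- Right multiplication by `a⁻¹ * b` carries `a` to the interior point `b` and preserves distances
  -- of translates.
  have hnhds : ∀ᶠ y in 𝓝 a, y * (a⁻¹ * b) ∈
      interior {y | dist (f.leftTranslate y) (f.leftTranslate x.1) ≤ ε / 3} :=
    (continuous_mul_const (a⁻¹ * b)).continuousAt.eventually_mem
      (isOpen_interior.mem_nhds (by simpa using hb))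
  filter_upwards [hnhds] with y hy
  rw [← f.dist_leftTranslate_mul_right y a (a⁻¹ * b), mul_inv_cancel_left]
  have h1 := interior_subset hy
  have h2 := interior_subset hb
  rw [mem_ofPred_eq] at h1 h2
  linarith [dist_triangle_right (f.leftTranslate (y * (a⁻¹ * b))) (f.leftTranslate b)
    (f.leftTranslate x.1)]

/-- **Ellis' joint continuity theorem**, compact case with continuous inversion: a separately
continuous multiplication is jointly continuous. -/
theorem continuousMul_of_separatelyContinuousMul [ContinuousInv G] : ContinuousMul G := by
  refine ⟨continuous_iff_continuousAt.2 fun p => ?_⟩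
  rw [ContinuousAt, tendsto_def]
  intro V hV
  obtain ⟨U, hUV, hUo, hpU⟩ := mem_nhds_iff.1 hV
  obtain ⟨f, hf0, hf1, -⟩ := exists_continuous_zero_one_of_isClosed
    (isClosed_singleton (x := p.1 * p.2)) hUo.isClosed_compl
    (by simpa [disjoint_singleton_left] using hpU)
  have hc : Continuous fun q : G × G => f.leftTranslate q.1 q.2 :=
    (f.continuous_leftTranslate.comp continuous_fst).eval continuous_snd
  have hp : f.leftTranslate p.1 p.2 < 1 := by
    have : f (p.1 * p.2) = 0 := hf0 rfl
    simp [ContinuousMap.leftTranslate, this]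
  filter_upwards [hc.continuousAt.eventually_lt continuousAt_const hp] with q hq
  refine hUV (by_contra fun hqU => ?_)
  have h1 : f (q.1 * q.2) = 1 := hf1 hqU
  simp [ContinuousMap.leftTranslate, h1] at hq

end Ellis

/-! ### Almost automorphy and the enveloping semigroup. -/

section EnvelopingSemigroup

variable {T : Type u} {X : Type v} [Group T] [TopologicalSpace X] [MulAction T X]

/-- The translation by `t` as an element of the enveloping semigroup. -/
def envelopingSemigroup.ofElement (T : Type u) (X : Type v) [Group T] [TopologicalSpace X]
    [MulAction T X] (t : T) : envelopingSemigroup T X :=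
  ⟨fun x => t • x, subset_closure ⟨t, rfl⟩⟩

theorem envelopingSemigroup.denseRange_ofElement :
    DenseRange (envelopingSemigroup.ofElement T X) := by
  intro p
  rw [closure_subtype, ← range_comp]
  exact p.2

theorem envelopingSemigroup.tendsto_iff {α : Type*} {F : Filter α}
    {g : α → envelopingSemigroup T X} {p : envelopingSemigroup T X} :
    Tendsto g F (𝓝 p) ↔ ∀ x, Tendsto (fun a => (g a).1 x) F (𝓝 (p.1 x)) := by
  rw [tendsto_subtype_rng, tendsto_pi_nhds]

instance [CompactSpace X] : CompactSpace (envelopingSemigroup T X) :=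
  isCompact_iff_compactSpace.1 isClosed_closure.isCompact

variable [CompactSpace X] [T2Space X]

theorem IsAlmostAutomorphic.exists_comp_eq_id (h : ∀ x : X, IsAlmostAutomorphic T x)
    (p : envelopingSemigroup T X) : ∃ q : envelopingSemigroup T X, ∀ x, q.1 (p.1 x) = x := by
  have hne : (comap (envelopingSemigroup.ofElement T X) (𝓝 p)).NeBot :=
    comap_neBot_iff_frequently.2 (by
      simpa using mem_closure_iff_frequently.1 (envelopingSemigroup.denseRange_ofElement p))
  let U := Ultrafilter.of (comap (envelopingSemigroup.ofElement T X) (𝓝 p))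
  have hU : Tendsto (envelopingSemigroup.ofElement T X) U (𝓝 p) :=
    tendsto_comap.mono_left (Ultrafilter.of_le _)
  let V := U.map fun t => envelopingSemigroup.ofElement T X t⁻¹
  have hV : Tendsto (fun t => envelopingSemigroup.ofElement T X t⁻¹) U (𝓝 V.lim) := V.le_nhds_lim
  refine ⟨V.lim, fun x => ?_⟩
  exact tendsto_nhds_unique (envelopingSemigroup.tendsto_iff.1 hV (p.1 x))
    ((isAlmostAutomorphic_iff_filter x).1 (h x) U (p.1 x)
      (envelopingSemigroup.tendsto_iff.1 hU x))

theorem isCompactHausdorffTopologicalGroup_of_isAlmostAutomorphic [ContinuousConstSMul T X]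
    (h : ∀ x : X, IsAlmostAutomorphic T x) :
    IsCompactHausdorffTopologicalGroup (envelopingSemigroup T X) := by
  choose j hj using IsAlmostAutomorphic.exists_comp_eq_id h
  let _ : One (envelopingSemigroup T X) := ⟨envelopingSemigroup.ofElement T X 1⟩
  let _ : Inv (envelopingSemigroup T X) := ⟨j⟩
  let G : Group (envelopingSemigroup T X) := Group.ofLeftAxioms mul_assoc
    (fun p => Subtype.ext (funext fun x => one_smul T (p.1 x)))
    (fun p => Subtype.ext (funext fun x => (hj p x).trans (one_smul T x).symm))
  have hinv_mul : ∀ (p : envelopingSemigroup T X) (x : X), p⁻¹.1 (p.1 x) = x := hj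
  have hmul_inv : ∀ (p : envelopingSemigroup T X) (x : X), p.1 (p⁻¹.1 x) = x := fun p x => by
    simpa only [inv_inv] using hinv_mul p⁻¹ x
  have hinv : ∀ t : T, (envelopingSemigroup.ofElement T X t)⁻¹ =
      envelopingSemigroup.ofElement T X t⁻¹ := fun t =>
    inv_eq_of_mul_eq_one_right (Subtype.ext (funext fun x =>
      (smul_inv_smul t x).trans (one_smul T x).symm))
  have hlim : ∀ p : envelopingSemigroup T X,
      Tendsto (fun q => q⁻¹) (𝓝[range (envelopingSemigroup.ofElement T X)] p) (𝓝 p⁻¹) := by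
    intro p
    rw [nhdsWithin, ← map_comap, tendsto_map'_iff, envelopingSemigroup.tendsto_iff]
    intro x
    -- As `t → p`, the points `t • p⁻¹ x` tend to `x`, so `t⁻¹ • x → p⁻¹ x`.
    have hx := (isAlmostAutomorphic_iff_filter (p⁻¹.1 x)).1 (h (p⁻¹.1 x))
      (comap (envelopingSemigroup.ofElement T X) (𝓝 p)) x
      (by
        have := envelopingSemigroup.tendsto_iff.1
          (tendsto_comap (f := envelopingSemigroup.ofElement T X) (x := 𝓝 p)) (p⁻¹.1 x)
        rwa [hmul_inv] at this)
    refine hx.congr fun t => ?_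
    rw [Function.comp_apply, hinv]
    rfl
  have hd : Dense (range (envelopingSemigroup.ofElement T X)) :=
    envelopingSemigroup.denseRange_ofElement
  have : ContinuousInv (envelopingSemigroup T X) := ⟨by
    have hc := continuous_extendFrom hd fun p => ⟨_, hlim p⟩
    exact hc.congr fun p => extendFrom_eq (hd p) (hlim p)⟩
  have hright : ∀ q : envelopingSemigroup T X, Continuous fun p => p * q := fun q =>
    continuous_induced_rng.2 (continuous_pi fun x =>
      (continuous_apply (q.1 x)).comp continuous_subtype_val)
  have : SeparatelyContinuousMul (envelopingSemigroup T X) :=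
    { continuous_mul_const := hright _
      continuous_const_mul := fun {p} => by
        -- `p * q = (q⁻¹ * p⁻¹)⁻¹`.
        simpa [Function.comp_def] using
          continuous_inv.comp ((hright p⁻¹).comp continuous_inv) }
  have := continuousMul_of_separatelyContinuousMul (G := envelopingSemigroup T X)
  exact ⟨G, rfl, {}, inferInstance, inferInstance⟩

theorem IsCompactHausdorffTopologicalGroup.isAlmostAutomorphic [ContinuousConstSMul T X]
    (h : IsCompactHausdorffTopologicalGroup (envelopingSemigroup T X)) (x : X) :
    IsAlmostAutomorphic T x := by
  obtain ⟨G, hG, htop, -, -⟩ := h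
  have hmul : ∀ (p q : envelopingSemigroup T X) (x : X), (p * q).1 x = p.1 (q.1 x) := by
    intro p q x
    exact congrFun (congrArg (fun S : Semigroup (envelopingSemigroup T X) => (S.mul p q).1) hG) x
  -- Only the product of `G` is known; its unit is identified as the sole idempotent.
  have hone : envelopingSemigroup.ofElement T X 1 = 1 :=
    mul_eq_left.1 (Subtype.ext (funext fun x => (hmul _ _ x).trans (one_smul T _)) :
      envelopingSemigroup.ofElement T X 1 * envelopingSemigroup.ofElement T X 1 = _)
  have hinv : ∀ t : T, (envelopingSemigroup.ofElement T X t)⁻¹ =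
      envelopingSemigroup.ofElement T X t⁻¹ := fun t =>
    inv_eq_of_mul_eq_one_right (Subtype.ext (funext fun x => by
      rw [hmul, ← hone]
      exact (smul_inv_smul t x).trans (one_smul T x).symm))
  rw [isAlmostAutomorphic_iff_filter]
  intro F y hF
  rw [tendsto_iff_ultrafilter]
  intro U hU
  -- By compactness `t → p := V.lim` along `U`, with `p x = y`; continuity of inversion then gives
  -- `t⁻¹ • y → p⁻¹ y = x`.
  let V := U.map (envelopingSemigroup.ofElement T X)
  have hV : Tendsto (envelopingSemigroup.ofElement T X) U (𝓝 V.lim) := V.le_nhds_lim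
  have hy : V.lim.1 x = y :=
    tendsto_nhds_unique (envelopingSemigroup.tendsto_iff.1 hV x) (hF.mono_left hU)
  have hx : V.lim⁻¹.1 y = x := by
    rw [← hy, ← hmul, inv_mul_cancel, ← hone]
    exact one_smul T x
  have hVinv := envelopingSemigroup.tendsto_iff.1 hV.inv y
  rw [hx] at hVinv
  refine hVinv.congr fun t => ?_
  rw [hinv]
  rfl

end EnvelopingSemigroup

theorem mainTheorem3 {T : Type u} {X : Type v} [Group T] [TopologicalSpace T]
    [IsTopologicalGroup T] [TopologicalSpace X] [CompactSpace X] [T2Space X] [MulAction T X]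
    [ContinuousSMul T X] :
    (∀ x : X, IsAlmostAutomorphic T x) ↔
      IsCompactHausdorffTopologicalGroup (envelopingSemigroup T X) :=
  ⟨isCompactHausdorffTopologicalGroup_of_isAlmostAutomorphic, fun h x => h.isAlmostAutomorphic x⟩
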